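/- For a finite connected graph $G$ let $H(G)=\sum_{\{u,v\}\subseteq V(G),\,u\ne v}\frac{1}{d(u,v)}$ be its Harary index, where $d(u,v)$ is the distance in $G$ and the sum runs over unordered pairs of distinct vertices. For integers $n_1\ge n_2\ge\dots\ge n_k\ge 1$ let $S(n_1,\dots,n_k)$ be the tree on $n_1+\dots+n_k+1$ vertices formed by a central vertex $v$ and $k$ disjoint paths with $n_1,\dots,n_k$ vertices, respectively, each joined to $v$ by an edge at one of its endpoints. For nonincreasing integer arrays $x=(x_1,\dots,x_k)$ and $y=(y_1,\dots,y_k)$ write $x\prec y$ ($y$ majorizes $x$) if $x_1+\dots+x_m\le y_1+\dots+y_m$ for all $1\le m<k$ and $x_1+\dots+x_k=y_1+\dots+y_k$. **Theorem.** Let $k\ge 2$, and let $p=(p_1,\dots,p_k)$ and $q=(q_1,\dots,q_k)$ be nonincreasing arrays of positive integers with $p\prec q$ (in particular, with the same sum). Then $$H(S(p_1,p_2,\dots,p_k))\ \ge\ H(S(q_1,q_2,\dots,q_k)).$$ Moreover, $\prec$ is a partial order (reflexive, antisymmetric and transitive) on the nonincreasing arrays of $k$ positive integers, so that the trees $S(p_1,\dots,p_k)$,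 indexed by these arrays, are partially ordered by $\prec$, and $H$ is order-reversing. -/

import Mathlib

/-- The Harary index of a finite graph (meant for connected graphs): the half-sum of the entries
`1 / d(u, v)`, `u ≠ v`, of the reciprocal distance matrix; every unordered pair of distinct
vertices thus contributes `1 / d(u, v)` once. -/
noncomputable def hararyIndex {V : Type*} [Fintype V] [DecidableEq V] (G : SimpleGraph V) : ℝ :=
  (∑ u : V, ∑ v : V, if u = v then 0 else 1 / (G.dist u v : ℝ)) / 2

/-- The tree `S(n₁, …, n_k)`: a central vertex `none`, and for each `i` a pendent path with the
`n i` vertices `(i, 0), …, (i, n i - 1)`, attached to the center by its first vertex `(i, 0)`. -/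
def starlikeTree {k : ℕ} (n : Fin k → ℕ) : SimpleGraph (Option (Σ i : Fin k, Fin (n i))) :=
  SimpleGraph.fromRel fun u v =>
    match u, v with
    | none, some b => (b.2 : ℕ) = 0
    | some a, some b => a.1 = b.1 ∧ (a.2 : ℕ) + 1 = (b.2 : ℕ)
    | _, none => False

/-- `Majorizes x y` is `x ≻ y`: both arrays are nonincreasing, each sum of the first `m` entries
of `x` (`1 ≤ m < n`) is at least that of `y`, and the total sums agree. -/
def Majorizes {n : ℕ} (x y : Fin n → ℕ) : Prop :=
  (Antitone x ∧ Antitone y) ∧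
  (∀ m : ℕ, 1 ≤ m → m < n →
    ∑ i ∈ Finset.univ.filter (fun i : Fin n => (i : ℕ) < m), y i ≤
      ∑ i ∈ Finset.univ.filter (fun i : Fin n => (i : ℕ) < m), x i) ∧
  ∑ i, x i = ∑ i, y i

/-! Attaching a leaf raises the Harary index by the sum of reciprocal distances from the leaf to the
old vertices. Compare attaching it to arm `i` or to arm `j` of the same tree. The leaf, the center
and these two arms form a path ending at the leaf, so their contribution is the same harmonic sum in
both cases; every other vertex is farther when the arm chosen is longer. Hence the longer arm gains
less (`hararyIndex_update_le`). When `q` majorizes `p`, unit transfers from larger to smaller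
entries lead from `q` to `p`, and no transfer lowers the index (`hararyIndex_le_of_partial_sums`).
-/

/-! ### Distances in starlike trees -/

/-- A function `D` on pairs of vertices is the graph distance as soon as it is `1`-Lipschitz along
edges, vanishes exactly on the diagonal, and can always be decreased by one along some edge. -/
theorem SimpleGraph.dist_eq_of_descent {V : Type*} (G : SimpleGraph V) (D : V → V → ℕ)
    (h0 : ∀ u, D u u = 0) (heq : ∀ u v, D u v = 0 → u = v)
    (hlip : ∀ u v w, G.Adj v w → D u v ≤ D u w + 1)
    (hdesc : ∀ u v n, D u v = n + 1 → ∃ w, G.Adj v w ∧ D u w = n) (u v : V) :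
    G.dist u v = D u v := by
  have hwalk : ∀ n v, D u v = n → ∃ w : G.Walk v u, w.length = n := by
    intro n
    induction n with
    | zero => intro v hv; obtain rfl := heq _ _ hv; exact ⟨.nil, rfl⟩
    | succ n ih =>
      intro v hv
      obtain ⟨w, hvw, hw⟩ := hdesc u v n hv
      obtain ⟨p, hp⟩ := ih w hw
      exact ⟨.cons hvw p, by simp [hp]⟩
  have hlow : ∀ {v w : V} (p : G.Walk v w), D u v ≤ D u w + p.length := by
    intro v w p
    induction p with
    | nil => simp
    | cons h p ih => have := hlip u _ _ h; simp only [SimpleGraph.Walk.length_cons]; omega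
  obtain ⟨p, hp⟩ := hwalk _ v rfl
  rw [SimpleGraph.dist_comm]
  apply le_antisymm
  · exact hp ▸ SimpleGraph.dist_le p
  · obtain ⟨r, hr⟩ := (SimpleGraph.Walk.reachable p).exists_walk_length_eq_dist
    have := hlow r
    rw [h0, hr] at this
    omega

/-- The distance function of the starlike tree, in coordinates. -/
def starlikeDist {k : ℕ} (n : Fin k → ℕ) :
    Option (Σ i : Fin k, Fin (n i)) → Option (Σ i : Fin k, Fin (n i)) → ℕ
  | none, none => 0
  | none, some b => b.2 + 1
  | some a, none => a.2 + 1
  | some a, some b => if a.1 = b.1 then Nat.dist a.2 b.2 else a.2 + b.2 + 2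

theorem starlikeTree_adj_center {k : ℕ} {n : Fin k → ℕ} (b : Σ i : Fin k, Fin (n i)) :
    (starlikeTree n).Adj none (some b) ↔ (b.2 : ℕ) = 0 := by
  simp [starlikeTree]

theorem starlikeTree_adj_arm {k : ℕ} {n : Fin k → ℕ} (a b : Σ i : Fin k, Fin (n i)) :
    (starlikeTree n).Adj (some a) (some b) ↔
      a.1 = b.1 ∧ ((a.2 : ℕ) + 1 = b.2 ∨ (b.2 : ℕ) + 1 = a.2) := by
  simp only [starlikeTree, SimpleGraph.fromRel_adj]
  constructor
  · rintro ⟨-, h | h⟩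
    · exact ⟨h.1, Or.inl h.2⟩
    · exact ⟨h.1.symm, Or.inr h.2⟩
  · rintro ⟨h, h'⟩
    refine ⟨?_, h'.imp (fun e => ⟨h, e⟩) fun e => ⟨h.symm, e⟩⟩
    intro e
    obtain rfl := Option.some.inj e
    omega

theorem starlikeTree_dist {k : ℕ} (n : Fin k → ℕ) (u v : Option (Σ i : Fin k, Fin (n i))) :
    (starlikeTree n).dist u v = starlikeDist n u v := by
  apply SimpleGraph.dist_eq_of_descent
  · rintro (_ | a) <;> simp [starlikeDist]
  · rintro (_ | ⟨i, a, ha⟩) (_ | ⟨j, b, hb⟩) h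
    · rfl
    · simp [starlikeDist] at h
    · simp [starlikeDist] at h
    · simp only [starlikeDist] at h
      split_ifs at h with hij
      obtain rfl : i = j := hij
      obtain rfl := Nat.eq_of_dist_eq_zero h
      rfl
  · rintro u (_ | ⟨i, a, ha⟩) (_ | ⟨j, b, hb⟩) h
    · simp at h
    · rw [starlikeTree_adj_center] at h
      rcases u with _ | ⟨l, c, hc⟩ <;> simp only [starlikeDist, Nat.dist] at h ⊢
      · omega
      · split_ifs <;> omega
    · rw [SimpleGraph.adj_comm, starlikeTree_adj_center] at h
      rcases u with _ | ⟨l, c, hc⟩ <;> simp only [starlikeDist, Nat.dist] at h ⊢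
      · omega
      · split_ifs <;> omega
    · rw [starlikeTree_adj_arm] at h
      obtain ⟨hij, h⟩ := h
      obtain rfl : i = j := hij
      rcases u with _ | ⟨l, c, hc⟩ <;> simp only [starlikeDist, Nat.dist] at h ⊢
      · omega
      · split_ifs <;> omega
  · rintro (_ | ⟨i, a, ha⟩) (_ | ⟨j, b, hb⟩) m h
    · simp [starlikeDist] at h
    · simp only [starlikeDist] at h
      rcases b with _ | b
      · exact ⟨none, ((starlikeTree_adj_center _).2 rfl).symm, by simp [starlikeDist]; omega⟩
      · exact ⟨some ⟨j, b, by omega⟩, (starlikeTree_adj_arm _ _).2 ⟨rfl, Or.inr rfl⟩,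
          by simp [starlikeDist]; omega⟩
    · simp only [starlikeDist] at h
      exact ⟨some ⟨i, 0, by omega⟩, (starlikeTree_adj_center _).2 rfl,
        by simp [starlikeDist, Nat.dist]; omega⟩
    · simp only [starlikeDist] at h
      split_ifs at h with hij
      · obtain rfl : i = j := hij
        simp only [Nat.dist] at h
        rcases lt_or_ge a b with hab | hab
        · exact ⟨some ⟨i, b - 1, by omega⟩,
            (starlikeTree_adj_arm _ _).2 ⟨rfl, Or.inr (by simp; omega)⟩,
            by simp [starlikeDist, Nat.dist]; omega⟩
        · exact ⟨some ⟨i, b + 1, by omega⟩,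
            (starlikeTree_adj_arm _ _).2 ⟨rfl, Or.inl rfl⟩,
            by simp [starlikeDist, Nat.dist]; omega⟩
      · rcases b with _ | b
        · exact ⟨none, ((starlikeTree_adj_center _).2 rfl).symm, by simp [starlikeDist]; omega⟩
        · exact ⟨some ⟨j, b, by omega⟩, (starlikeTree_adj_arm _ _).2 ⟨rfl, Or.inr rfl⟩,
            by simp only [starlikeDist, if_neg hij] at h ⊢; omega⟩

/-! ### The Harary index as a sum over pairs of arms -/

/-- The sum of `1 / (s + t)` over `1 ≤ s ≤ a` and `1 ≤ t ≤ b`: the contribution to the Harary index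
of the pairs of vertices on two different arms. -/
noncomputable def crossSum (a b : ℕ) : ℝ :=
  ∑ s ∈ Finset.range a, ∑ t ∈ Finset.range b, 1 / ((s : ℝ) + t + 2)

/-- Twice the Harary index of the path formed by the center and one arm with `a` vertices. -/
noncomputable def armSum (a : ℕ) : ℝ :=
  2 * ∑ s ∈ Finset.range a, 1 / ((s : ℝ) + 1) +
    ∑ s ∈ Finset.range a, ∑ t ∈ Finset.range a, 1 / (Nat.dist s t : ℝ)

theorem crossSum_comm (a b : ℕ) : crossSum a b = crossSum b a := by
  unfold crossSum
  rw [Finset.sum_comm]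
  simp only [add_comm]

theorem crossSum_succ (a b : ℕ) :
    crossSum (a + 1) b = crossSum a b + ∑ t ∈ Finset.range b, 1 / ((a : ℝ) + t + 2) := by
  simp [crossSum, Finset.sum_range_succ]

/-- The new end vertex has distances `1, …, a + 1` to the center and the old arm; ordered pairs
count each twice. -/
theorem armSum_succ (a : ℕ) :
    armSum (a + 1) = armSum a + 2 * ∑ s ∈ Finset.range (a + 1), 1 / ((s : ℝ) + 1) := by
  have h : ∑ s ∈ Finset.range a, 1 / (Nat.dist s a : ℝ) =
      ∑ s ∈ Finset.range a, 1 / ((s : ℝ) + 1) := by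
    rw [← Finset.sum_range_reflect]
    refine Finset.sum_congr rfl fun s hs => ?_
    have : Nat.dist (a - 1 - s) a = s + 1 := by
      have := Finset.mem_range.1 hs
      simp only [Nat.dist]; omega
    rw [this]; push_cast; rfl
  have h' : ∑ s ∈ Finset.range a, 1 / (Nat.dist a s : ℝ) =
      ∑ s ∈ Finset.range a, 1 / ((s : ℝ) + 1) := by
    simp only [Nat.dist_comm a, h]
  simp only [armSum, Finset.sum_range_succ, Finset.sum_add_distrib, h, h', Nat.dist_self]
  simp only [Nat.cast_zero, div_zero]
  ring

/-- The contribution of the ordered pair of arms `(i, j)` to twice the Harary index. -/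
noncomputable def armPair {k : ℕ} (n : Fin k → ℕ) (i j : Fin k) : ℝ :=
  if i = j then armSum (n i) else crossSum (n i) (n j)

theorem armPair_comm {k : ℕ} (n : Fin k → ℕ) (i j : Fin k) : armPair n i j = armPair n j i := by
  unfold armPair
  by_cases h : i = j
  · simp [h]
  · rw [if_neg h, if_neg (Ne.symm h), crossSum_comm]

theorem hararyIndex_starlikeTree {k : ℕ} (n : Fin k → ℕ) :
    hararyIndex (starlikeTree n) = (∑ i, ∑ j, armPair n i j) / 2 := by
  have hsplit : ∀ i, ∑ j, armPair n i j =
      2 * ∑ s ∈ Finset.range (n i), 1 / ((s : ℝ) + 1) + ∑ j,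
        if i = j then ∑ s ∈ Finset.range (n i), ∑ t ∈ Finset.range (n i), 1 / (Nat.dist s t : ℝ)
        else crossSum (n i) (n j) := by
    intro i
    rw [← Finset.add_sum_erase _ _ (Finset.mem_univ i),
      ← Finset.add_sum_erase (a := i) _ _ (Finset.mem_univ i), ← add_assoc]
    congr 1
    · simp [armPair, armSum]
    · refine Finset.sum_congr rfl fun j hj => ?_
      have : i ≠ j := (Finset.ne_of_mem_erase hj).symm
      simp [armPair, this]
  -- The convention `1 / 0 = 0` absorbs the diagonal terms.
  have hif : ∀ u v : Option (Σ i : Fin k, Fin (n i)),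
      (if u = v then 0 else 1 / ((starlikeTree n).dist u v : ℝ)) = 1 / (starlikeDist n u v : ℝ) := by
    intro u v
    rw [← starlikeTree_dist]
    split_ifs with h
    · simp [h]
    · rfl
  unfold hararyIndex
  simp only [hif, Fintype.sum_option, hsplit]
  congr 1
  simp only [starlikeDist, Fintype.sum_sigma, Finset.sum_add_distrib, ← Finset.mul_sum]
  have hc : ∀ i, ∑ a : Fin (n i), 1 / (((a : ℕ) + 1 : ℕ) : ℝ) =
      ∑ s ∈ Finset.range (n i), 1 / ((s : ℝ) + 1) := by
    intro i
    rw [← Fin.sum_univ_eq_sum_range (fun s => 1 / ((s : ℝ) + 1))]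
    push_cast; rfl
  have hp : ∀ i, ∑ a : Fin (n i), ∑ j, ∑ b : Fin (n j),
        1 / ((if i = j then Nat.dist a b else (a : ℕ) + b + 2 : ℕ) : ℝ) = ∑ j,
        if i = j then ∑ s ∈ Finset.range (n i), ∑ t ∈ Finset.range (n i), 1 / (Nat.dist s t : ℝ)
        else crossSum (n i) (n j) := by
    intro i
    rw [Finset.sum_comm]
    refine Finset.sum_congr rfl fun j _ => ?_
    split_ifs with h
    · subst h
      rw [← Fin.sum_univ_eq_sum_range
        (fun s => ∑ t ∈ Finset.range (n i), 1 / (Nat.dist s t : ℝ))]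
      refine Finset.sum_congr rfl fun a _ => ?_
      rw [← Fin.sum_univ_eq_sum_range (fun t => 1 / (Nat.dist a t : ℝ))]
    · unfold crossSum
      rw [← Fin.sum_univ_eq_sum_range
        (fun s => ∑ t ∈ Finset.range (n j), 1 / ((s : ℝ) + t + 2))]
      refine Finset.sum_congr rfl fun a _ => ?_
      rw [← Fin.sum_univ_eq_sum_range (fun t => 1 / (((a : ℕ) : ℝ) + t + 2))]
      push_cast; rfl
  simp only [hc, hp]
  simp
  ring

/-- Isolates row and column `i`, the only entries that change when arm `i` grows. -/
theorem sum_sum_eq_of_symm {ι : Type*} [Fintype ι] [DecidableEq ι] (A : ι → ι → ℝ)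
    (hA : ∀ i j, A i j = A j i) (i : ι) :
    ∑ x, ∑ y, A x y = A i i + 2 * ∑ y ∈ Finset.univ.erase i, A i y +
      ∑ x ∈ Finset.univ.erase i, ∑ y ∈ Finset.univ.erase i, A x y := by
  rw [← Finset.add_sum_erase _ _ (Finset.mem_univ i)]
  simp only [← Finset.add_sum_erase Finset.univ _ (Finset.mem_univ i), Finset.sum_add_distrib,
    hA _ i]
  ring

/-! ### Gain from one new leaf -/

/-- The increase of twice the Harary index when arm `i` gets one more vertex. -/
theorem sum_armPair_update {k : ℕ} (m : Fin k → ℕ) (i : Fin k) :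
    ∑ x, ∑ y, armPair (Function.update m i (m i + 1)) x y = ∑ x, ∑ y, armPair m x y +
      2 * (∑ s ∈ Finset.range (m i + 1), 1 / ((s : ℝ) + 1) +
        ∑ l ∈ Finset.univ.erase i, ∑ t ∈ Finset.range (m l), 1 / ((m i : ℝ) + t + 2)) := by
  rw [sum_sum_eq_of_symm _ (armPair_comm _) i, sum_sum_eq_of_symm _ (armPair_comm m) i]
  have h1 : ∑ y ∈ Finset.univ.erase i, armPair (Function.update m i (m i + 1)) i y =
      ∑ y ∈ Finset.univ.erase i, armPair m i y +
        ∑ l ∈ Finset.univ.erase i, ∑ t ∈ Finset.range (m l), 1 / ((m i : ℝ) + t + 2) := by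
    rw [← Finset.sum_add_distrib]
    refine Finset.sum_congr rfl fun y hy => ?_
    have hy' := Finset.ne_of_mem_erase hy
    simp only [armPair, if_neg hy'.symm, Function.update_self, Function.update_of_ne hy',
      crossSum_succ]
  have h2 : ∑ x ∈ Finset.univ.erase i, ∑ y ∈ Finset.univ.erase i,
      armPair (Function.update m i (m i + 1)) x y =
      ∑ x ∈ Finset.univ.erase i, ∑ y ∈ Finset.univ.erase i, armPair m x y := by
    refine Finset.sum_congr rfl fun x hx => Finset.sum_congr rfl fun y hy => ?_
    simp only [armPair, Function.update_of_ne (Finset.ne_of_mem_erase hx),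
      Function.update_of_ne (Finset.ne_of_mem_erase hy)]
  rw [h1, h2]
  simp only [armPair, if_true, Function.update_self, armSum_succ]
  ring

/-- The right side is symmetric in `a` and `b`: this is the part of the gain that does not depend on
which of two arms grows. -/
theorem sum_harmonic_add (a b : ℕ) :
    ∑ s ∈ Finset.range (a + 1), 1 / ((s : ℝ) + 1) +
      ∑ t ∈ Finset.range b, 1 / ((a : ℝ) + t + 2) =
    ∑ s ∈ Finset.range (a + b + 1), 1 / ((s : ℝ) + 1) := by
  induction b with
  | zero => simp
  | succ b ih =>
    rw [Finset.sum_range_succ _ b, ← add_assoc, ih, ← add_assoc a b 1,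
      Finset.sum_range_succ _ (a + b + 1)]
    push_cast
    ring

/-- Attaching a new vertex to a longer arm gives a smaller Harary index. -/
theorem hararyIndex_update_le {k : ℕ} (m : Fin k → ℕ) (i j : Fin k) (h : m j ≤ m i) :
    hararyIndex (starlikeTree (Function.update m i (m i + 1))) ≤
      hararyIndex (starlikeTree (Function.update m j (m j + 1))) := by
  rcases eq_or_ne i j with rfl | hij
  · rfl
  have hgain : ∀ i j, i ≠ j → ∑ s ∈ Finset.range (m i + 1), 1 / ((s : ℝ) + 1) +
      ∑ l ∈ Finset.univ.erase i, ∑ t ∈ Finset.range (m l), 1 / ((m i : ℝ) + t + 2) =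
      ∑ s ∈ Finset.range (m i + m j + 1), 1 / ((s : ℝ) + 1) +
        ∑ l ∈ (Finset.univ.erase i).erase j,
          ∑ t ∈ Finset.range (m l), 1 / ((m i : ℝ) + t + 2) := by
    intro i j hij
    rw [← sum_harmonic_add, add_assoc, Finset.add_sum_erase (Finset.univ.erase i)
      (fun l => ∑ t ∈ Finset.range (m l), 1 / ((m i : ℝ) + t + 2))
      (Finset.mem_erase.2 ⟨hij.symm, Finset.mem_univ j⟩)]
  rw [hararyIndex_starlikeTree, hararyIndex_starlikeTree, sum_armPair_update, sum_armPair_update,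
    hgain i j hij, hgain j i hij.symm, Finset.erase_right_comm, add_comm (m j) (m i)]
  gcongr

/-! ### Unit transfers and majorization -/

/-- If `p` is nonincreasing and the partial sums of `q` dominate those of `p`, with the same total,
then the starlike tree of `q` has the smaller Harary index. Here `q` need not be nonincreasing,
which lets unit transfers be carried out without sorting. -/
theorem hararyIndex_le_of_partial_sums {k : ℕ} (p : Fin k → ℕ) (hp : Antitone p) (q : Fin k → ℕ)
    (hle : ∀ m : ℕ, ∑ i ∈ Finset.univ.filter (fun i : Fin k => (i : ℕ) < m), p i ≤
      ∑ i ∈ Finset.univ.filter (fun i : Fin k => (i : ℕ) < m), q i)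
    (hsum : ∑ i, q i = ∑ i, p i) :
    hararyIndex (starlikeTree q) ≤ hararyIndex (starlikeTree p) := by
  -- Truncated subtraction makes this the total excess of `q` over `p`.
  induction hN : ∑ i, (q i - p i) using Nat.strong_induction_on generalizing q with
  | _ N ih =>
  by_cases hqp : ∀ i, p i ≤ q i
  · have : p = q := by
      funext i
      exact (Finset.sum_eq_sum_iff_of_le fun i _ => hqp i).1 hsum.symm i (Finset.mem_univ i)
    rw [this]
  push Not at hqp
  obtain ⟨j, hj, hjmin⟩ := WellFounded.has_min (wellFounded_lt (α := Fin k))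
    {j | q j < p j} hqp
  have hjmin' : ∀ l < j, p l ≤ q l := fun l hl => by
    by_contra h
    exact hjmin l (not_le.1 h) hl
  -- Without an excess before the first deficit `j`, the partial sum of `q` through `j` would be too
  -- small.
  obtain ⟨i, hij, hi⟩ : ∃ i < j, p i < q i := by
    by_contra! h
    refine absurd (hle (j + 1)) (not_le.2 ?_)
    refine Finset.sum_lt_sum (fun l hl => ?_) ⟨j, by simp, hj⟩
    rcases (Nat.lt_succ_iff.1 (Finset.mem_filter.1 hl).2).lt_or_eq with hl | hl
    · exact h l hl
    · rw [Fin.ext hl]; exact (show q j < p j from hj).le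
  have hj' : q j < p j := hj
  have hpij := hp hij.le
  set m := Function.update q i (q i - 1) with hm
  have hmi : m i = q i - 1 := by simp [hm]
  have hmj : m j = q j := by simp [hm, hij.ne']
  have hq : q = Function.update m i (m i + 1) := by
    rw [hmi, hm, Function.update_idem, show q i - 1 + 1 = q i by omega, Function.update_eq_self]
  set r := Function.update m j (m j + 1) with hr
  have hri : r i = q i - 1 := by simp [hr, hij.ne, hmi]
  have hrj : r j = q j + 1 := by simp [hr, hmj]
  have hrl : ∀ l, l ≠ i → l ≠ j → r l = q l := fun l h h' => by simp [hr, hm, h, h']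
  have hstep : ∀ s : Finset (Fin k), ∑ l ∈ s, r l + (if i ∈ s then 1 else 0) =
      ∑ l ∈ s, q l + (if j ∈ s then 1 else 0) := by
    intro s
    rw [← Finset.sum_ite_eq' s i (fun _ => 1), ← Finset.sum_ite_eq' s j (fun _ => 1),
      ← Finset.sum_add_distrib, ← Finset.sum_add_distrib]
    refine Finset.sum_congr rfl fun l _ => ?_
    by_cases h : l = i
    · subst h; simp [hij.ne, hri]; omega
    · by_cases h' : l = j
      · subst h'; simp [hij.ne', hrj]
      · simp [h, h', hrl l h h']
  have hqr : hararyIndex (starlikeTree q) ≤ hararyIndex (starlikeTree r) := by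
    conv_lhs => rw [hq]
    -- Monotonicity of `p` enters here: `q j < p j ≤ p i < q i`.
    exact hararyIndex_update_le m i j (by omega)
  refine hqr.trans (ih _ ?_ r ?_ ?_ rfl)
  · rw [← hN]
    refine Finset.sum_lt_sum (fun l _ => ?_) ⟨i, Finset.mem_univ i, by omega⟩
    by_cases h : l = i
    · subst h; omega
    · by_cases h' : l = j
      · subst h'; omega
      · rw [hrl l h h']
  · intro a
    have hs := hstep (Finset.univ.filter fun l : Fin k => (l : ℕ) < a)
    have ha := hle a
    simp only [Finset.mem_filter, Finset.mem_univ, true_and] at hs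
    have hij' : (i : ℕ) < j := hij
    by_cases hja : (j : ℕ) < a
    · rw [if_pos hja, if_pos (hij'.trans hja)] at hs
      omega
    · rw [if_neg hja] at hs
      split_ifs at hs with hia
      -- A prefix containing `i` but not `j` loses one unit; its inequality was strict, as no
      -- deficit occurs before `j`.
      · have : ∑ l ∈ Finset.univ.filter (fun l : Fin k => (l : ℕ) < a), p l <
            ∑ l ∈ Finset.univ.filter (fun l : Fin k => (l : ℕ) < a), q l := by
          refine Finset.sum_lt_sum (fun l hl => hjmin' l ?_) ⟨i, by simpa using hia, hi⟩
          have := (Finset.mem_filter.1 hl).2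
          exact Fin.lt_def.2 (by omega)
        omega
      · omega
  · have hs := hstep Finset.univ
    simp only [Finset.mem_univ, if_true] at hs
    omega

theorem Majorizes.partial_sum_le {n : ℕ} {x y : Fin n → ℕ} (h : Majorizes x y) (m : ℕ) :
    ∑ i ∈ Finset.univ.filter (fun i : Fin n => (i : ℕ) < m), y i ≤
      ∑ i ∈ Finset.univ.filter (fun i : Fin n => (i : ℕ) < m), x i := by
  rcases Nat.eq_zero_or_pos m with rfl | hm
  · simp
  rcases lt_or_ge m n with hmn | hmn
  · exact h.2.1 m hm hmn
  · rw [Finset.filter_true_of_mem fun i _ => i.2.trans_le hmn]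
    exact h.2.2.ge

theorem Majorizes.antisymm {n : ℕ} {x y : Fin n → ℕ} (h : Majorizes x y) (h' : Majorizes y x) :
    x = y := by
  -- All partial sums agree, so their consecutive differences, the entries, do too.
  have hs := fun m => le_antisymm (h'.partial_sum_le m) (h.partial_sum_le m)
  funext i
  have hins : Finset.univ.filter (fun l : Fin n => (l : ℕ) < i + 1) =
      insert i (Finset.univ.filter fun l : Fin n => (l : ℕ) < i) := by
    ext l
    simp only [Finset.mem_filter, Finset.mem_univ, true_and, Finset.mem_insert, Fin.ext_iff]
    omega
  have h1 := hs (i + 1)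
  rw [hins, Finset.sum_insert (by simp), Finset.sum_insert (by simp), hs i] at h1
  omega

theorem theorem2p5 (k : ℕ) (hk : 2 ≤ k) :
    (∀ p q : Fin k → ℕ, (∀ i, 1 ≤ p i) → (∀ i, 1 ≤ q i) → Majorizes q p →
      hararyIndex (starlikeTree p) ≥ hararyIndex (starlikeTree q)) ∧
    -- majorization is a partial order on the nonincreasing arrays of positive integers
    (∀ p : Fin k → ℕ, (∀ i, 1 ≤ p i) → Antitone p → Majorizes p p) ∧
    (∀ p q : Fin k → ℕ, (∀ i, 1 ≤ p i) → (∀ i, 1 ≤ q i) →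
      Majorizes p q → Majorizes q p → p = q) ∧
    (∀ p q r : Fin k → ℕ, (∀ i, 1 ≤ p i) → (∀ i, 1 ≤ q i) → (∀ i, 1 ≤ r i) →
      Majorizes r q → Majorizes q p → Majorizes r p) := by
  refine ⟨fun p q _ _ h => ?_, fun p _ hp => ⟨⟨hp, hp⟩, fun _ _ _ => le_rfl, rfl⟩,
    fun p q _ _ h h' => h.antisymm h', fun p q r _ _ _ h h' => ?_⟩
  · exact hararyIndex_le_of_partial_sums p h.1.2 q h.partial_sum_le h.2.2
  · exact ⟨⟨h.1.1, h'.1.2⟩, fun m hm hmk => (h'.2.1 m hm hmk).trans (h.2.1 m hm hmk),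
      h.2.2.trans h'.2.2⟩
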